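/- For integers $m\ge 1$ and $k\ge 1$ let $T^m_k$ be the $m$-dimensional discrete torus: the graph with vertex set $(\mathbb Z/k\mathbb Z)^m$ in which two distinct vertices are adjacent if they differ by $\pm 1$ modulo $k$ in one coordinate and agree in all the others. A balanced colouring $(R,B)$ of a finite graph is a partition of its vertex set into two classes with $|R|=|B|$. For a class $S\in\{R,B\}$ let $P_2(S)$ be the probability that the simple random walk $(W_i)_{i\ge 0}$ whose starting vertex $W_0$ is uniformly random in $S$ (each step going to a uniformly random neighbour of the current vertex) satisfies $W_1,W_2\in S$. Let $\mathcal P(\mathcal T^m)$ be the set of all $(x,y)\in\mathbb R^2$ such that for every $\epsilon>0$ there are some $k\ge 1$ and a balanced colouring $(R,B)$ of $T^m_k$ with $|P_2(R)-x|<\epsilon$ and $|P_2(B)-y|<\epsilon$. For $S\subseteq\mathbb R^2$ let $\overline{\mathrm{conv}}(S)$ denote the symmetrised convex hull of $S$, that is, the convex hull of $S\cup\{(y,x):(x,y)\in S\}$, and let $D_4=\overline{\mathrm{conv}}\left(\left\{\left(\tfrac l4,\tfrac{l^2}{16}\right):0\le l\le 4\right\}\right)$. Theorem. $$\mathcal P(\mathcal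 T^2)=\overline{\mathrm{conv}}\left(\left\{(0,0),\left(\tfrac12,\tfrac14\right),\left(\tfrac34,\tfrac9{16}\right),(1,1)\right\}\right).$$ In particular, the points $\left(\tfrac14,\tfrac1{16}\right)$ and $\left(\tfrac1{16},\tfrac14\right)$ of $D_4$ do not belong to $\mathcal P(\mathcal T^2)$. Moreover, for every $k\ge 1$, every balanced colouring $(R,B)$ of $T^2_k$ and every real $\epsilon$, if $P_2(R)=\tfrac14+\epsilon$ then $P_2(B)\ge\tfrac18+\tfrac{\epsilon}{2}$. -/

import Mathlib

namespace TransitProb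

/-- The law of the first `t` steps of the simple random walk on `G` started at a uniformly random
vertex of `S`: the probability that `(W₀, …, W_t)` equals the given trajectory `w`. -/
noncomputable def walkLaw {V : Type*} [Fintype V] [DecidableEq V] (G : SimpleGraph V)
    [DecidableRel G.Adj] (S : Finset V) {t : ℕ} (w : Fin (t + 1) → V) : ℝ :=
  (if w 0 ∈ S then 1 / (S.card : ℝ) else 0) *
    ∏ i : Fin t, if G.Adj (w i.castSucc) (w i.succ) then 1 / (G.degree (w i.castSucc) : ℝ) else 0

/-- `P_t(S)`: the probability that the random walk started at a uniformly random vertex of `S`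
satisfies `W₁, …, W_t ∈ S`. -/
noncomputable def stayProb {V : Type*} [Fintype V] [DecidableEq V] (G : SimpleGraph V)
    [DecidableRel G.Adj] (t : ℕ) (S : Finset V) : ℝ :=
  ∑ w : Fin (t + 1) → V with ∀ i : Fin t, w i.succ ∈ S, walkLaw G S w

/-- A red/blue colouring is given by its red class `R`, the blue class being `Rᶜ`; it is balanced
if both classes have the same size. -/
def IsBalanced {V : Type*} [Fintype V] [DecidableEq V] (R : Finset V) : Prop :=
  R.card = Rᶜ.card

/-- The asymptotically achievable set of a sequence of finite graphs `G₁, G₂, …`. -/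
def achievableSet {V : ℕ+ → Type*} [∀ k, Fintype (V k)] [∀ k, DecidableEq (V k)]
    (G : ∀ k, SimpleGraph (V k)) [∀ k, DecidableRel (G k).Adj] : Set (ℝ × ℝ) :=
  {p | ∀ ε : ℝ, 0 < ε → ∃ (k : ℕ+) (R : Finset (V k)), IsBalanced R ∧
    |stayProb (G k) 2 R - p.1| < ε ∧ |stayProb (G k) 2 Rᶜ - p.2| < ε}

/-- The `m`-dimensional discrete torus of side `k`. The clause `x ≠ y` only matters for `k = 1`,
where it removes the loop. -/
def torus (m : ℕ) (k : ℕ+) : SimpleGraph (Fin m → ZMod k) where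
  Adj x y := x ≠ y ∧ ∃ j, (x j = y j + 1 ∨ x j = y j - 1) ∧ ∀ i, i ≠ j → x i = y i
  symm := ⟨by
    rintro x y ⟨hne, j, hj, h⟩
    refine ⟨hne.symm, j, ?_, fun i hi => (h i hi).symm⟩
    rcases hj with hj | hj
    · right; rw [hj]; ring
    · left; rw [hj]; ring⟩
  loopless := ⟨fun _ h => h.1 rfl⟩

instance (m : ℕ) (k : ℕ+) : DecidableRel (torus m k).Adj := fun x y =>
  inferInstanceAs (Decidable
    (x ≠ y ∧ ∃ j, (x j = y j + 1 ∨ x j = y j - 1) ∧ ∀ i, i ≠ j → x i = y i))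

/-- The symmetrised convex hull of a set of points of the plane: the convex hull of the set
together with its reflection in the diagonal. -/
def symmHull (S : Set (ℝ × ℝ)) : Set (ℝ × ℝ) :=
  convexHull ℝ (S ∪ Prod.swap '' S)

/-- The region `D_d`. -/
def regionD (d : ℕ) : Set (ℝ × ℝ) :=
  symmHull {p | ∃ l : ℕ, l ≤ d ∧ p = ((l : ℝ) / d, (l : ℝ) ^ 2 / (d : ℝ) ^ 2)}

end TransitProb

/-!
The walk on the two-dimensional torus of side `k ≥ 2` moves in each of the four lattice directions
with probability `1/4`, also for `k = 2`, where opposite directions lead to the same vertex. Hence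
`P₂(S)` is `1 / (16 |S|)` times the sum over `v ∈ S` of `N_S(v)²`, where `N_S(v)` counts the
directions that lead from `v` into `S` (`stayProb_torus_two`).

*Necessity.* Write `x = P₂(R)`, `y = P₂(B)`. Counting the edges between the two classes from both
sides gives `∑_{v ∈ R} N_R(v) = ∑_{v ∈ B} N_B(v)`. Together with `N_R² ≤ 4 N_R` and with
`(N_B - j)(N_B - j - 1) ≥ 0` for `j = 2, 3` this yields `y ≥ 5x/4 - 3/8` and `y ≥ 7x/4 - 3/4`
(`linear_le_sum_sq`). These two bounds would hold on any four-regular graph. The bound `y ≥ x/2`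
(`half_sum_sq_le`) uses the geometry. By the edge count it says that the charge `N_B (N_B - 2)` on
blue vertices and `N_R (4 - N_R) / 2` on red ones has nonnegative total. In this charge a
blue-blue-blue path of length two has weight `2`, a path red-red-blue with red midpoint has weight
`1/2`, and each blue-blue edge has weight `-1` at both of its ends. Straight paths may be dropped;
every other path turns a corner and so belongs to one unit square, and each edge is split equally
between the two unit squares containing it. The total over one unit square is `4` if the square is
entirely blue and `0` for each of the other fifteen colourings (`cornerWeight_square_nonneg`).

*Sufficiency.* Colourings are lifted to doubly periodic patterns on `ℤ²`, and a pattern is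
described by its profile: its red density and the averages of the red and blue path counts. Placing
two patterns in wide vertical strips averages their profiles up to a boundary error, with no error
in the density (`profileSet_midpoint`). The four extreme points come from the all-red pattern, its
colour swap, the checkerboard, and the patterns of isolated red points in which every blue point has
exactly two (`i + j ≡ 0` modulo `3`) or exactly three (`i + 2 j ≡ 0` modulo `5`) blue neighbours,
mixed in dyadic proportions of red density one half. The profiles of density one half form a closed
set that contains all midpoints, hence a convex set.
-/

namespace TransitProb

open Finset

/-! ### The walk on the two-dimensional torus -/

/-- The sum of `x` over the four lattice neighbours of `v`, counted with multiplicity when two of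
them coincide, as happens for `k = 2`. -/
def nbrSum {k : ℕ} (x : (Fin 2 → ZMod k) → ℝ) (v : Fin 2 → ZMod k) : ℝ :=
  x (v + ![1, 0]) + x (v - ![1, 0]) + x (v + ![0, 1]) + x (v - ![0, 1])

theorem torus_two_adj_iff {k : ℕ+} (hk : 2 ≤ (k : ℕ)) (a b : Fin 2 → ZMod k) :
    (torus 2 k).Adj a b ↔
      b ∈ ({a + ![1, 0], a - ![1, 0], a + ![0, 1], a - ![0, 1]} : Finset (Fin 2 → ZMod k)) := by
  have : Fact (1 < (k : ℕ)) := ⟨hk⟩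
  have h10 : (1 : ZMod k) ≠ 0 := one_ne_zero
  simp only [mem_insert, mem_singleton, torus, funext_iff, Fin.forall_fin_two,
    Fin.exists_fin_two, ne_eq, Pi.add_apply, Pi.sub_apply, Matrix.cons_val_zero,
    Matrix.cons_val_one]
  constructor
  · rintro ⟨-, ⟨h | h, -, h'⟩ | ⟨h | h, h', -⟩⟩ <;> simp_all
  · rintro (⟨h, h'⟩ | ⟨h, h'⟩ | ⟨h, h'⟩ | ⟨h, h'⟩) <;> simp_all [sub_eq_add_neg]

/-- The step law of the walk on the two-dimensional torus: a uniform choice among the four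
directions. For `k = 2` the degree is two and the directions coincide in pairs. -/
theorem torus_two_step {k : ℕ+} (hk : 2 ≤ (k : ℕ)) (a b : Fin 2 → ZMod k) :
    (if (torus 2 k).Adj a b then 1 / ((torus 2 k).degree a : ℝ) else 0) =
      nbrSum (fun c => if c = b then 1 else 0) a / 4 := by
  have hN : (torus 2 k).neighborFinset a =
      {a + ![1, 0], a - ![1, 0], a + ![0, 1], a - ![0, 1]} := by
    ext b
    rw [SimpleGraph.mem_neighborFinset, torus_two_adj_iff hk]
  have : Fact (1 < (k : ℕ)) := ⟨hk⟩
  have h10 : (1 : ZMod k) ≠ 0 := one_ne_zero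
  have c1 : a + ![1, 0] ≠ a + ![0, 1] := by
    intro h; have := congrFun h 0; simp at this
  rw [← SimpleGraph.card_neighborFinset_eq_degree, hN]
  simp only [torus_two_adj_iff hk, nbrSum]
  by_cases h2 : (1 : ZMod k) = -1
  · have d1 : a - ![1, 0] = a + ![1, 0] := by
      rw [sub_eq_add_neg]; congr 1; ext i; fin_cases i <;> simp [← h2]
    have d2 : a - ![0, 1] = a + ![0, 1] := by
      rw [sub_eq_add_neg]; congr 1; ext i; fin_cases i <;> simp [← h2]
    rw [d1, d2]
    generalize a + ![1, 0] = p, a + ![0, 1] = q at *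
    by_cases hp : p = b
    · subst hp; simp [c1, c1.symm]; norm_num
    · by_cases hq : q = b
      · subst hq; simp [c1]; norm_num
      · simp [hp, hq, Ne.symm hp, Ne.symm hq]
  · have c2 : a + ![1, 0] ≠ a - ![0, 1] := by
      intro h; have := congrFun h 0; simp at this
    have c3 : a - ![1, 0] ≠ a + ![0, 1] := by
      intro h; have := congrFun h 0; simp at this
    have c4 : a - ![1, 0] ≠ a - ![0, 1] := by
      intro h; have := congrFun h 0; simp at this
    have c5 : a + ![1, 0] ≠ a - ![1, 0] := by
      intro h; have := congrFun h 0; simp [sub_eq_add_neg] at this; exact h2 this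
    have c6 : a + ![0, 1] ≠ a - ![0, 1] := by
      intro h; have := congrFun h 1; simp [sub_eq_add_neg] at this; exact h2 this
    generalize a + ![1, 0] = p, a + ![0, 1] = q, a - ![1, 0] = r, a - ![0, 1] = s at *
    have hcard : ({p, r, q, s} : Finset (Fin 2 → ZMod k)).card = 4 := by
      rw [card_insert_of_notMem, card_insert_of_notMem, card_pair c6] <;> simp [*]
    rw [hcard]
    by_cases hp : p = b
    · subst hp; simp [c1.symm, c2.symm, c5.symm]
    by_cases hr : r = b
    · subst hr; simp [c3.symm, c4.symm, c5]
    by_cases hq : q = b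
    · subst hq; simp [c1, c3, c6.symm]
    by_cases hs : s = b
    · subst hs; simp [c2, c4, c6]
    simp [hp, hq, hr, hs, eq_comm (a := b)]

theorem stayProb_two_eq_sum {V : Type*} [Fintype V] [DecidableEq V] (G : SimpleGraph V)
    [DecidableRel G.Adj] (S : Finset V) :
    stayProb G 2 S = 1 / (S.card : ℝ) * ∑ a ∈ S, ∑ b ∈ S, ∑ c ∈ S,
      (if G.Adj a b then 1 / (G.degree a : ℝ) else 0) *
        (if G.Adj b c then 1 / (G.degree b : ℝ) else 0) := by
  let e : (Fin 3 → V) ≃ V × V × V :=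
    ⟨fun w => (w 0, w 1, w 2), fun p => ![p.1, p.2.1, p.2.2],
      fun w => by ext i; fin_cases i <;> rfl, fun p => rfl⟩
  have key : ∀ a b c : V,
      (if (∀ i : Fin 2, (![a, b, c] : Fin 3 → V) i.succ ∈ S) then
        walkLaw G S (t := 2) ![a, b, c] else 0) =
      if a ∈ S then if b ∈ S then if c ∈ S then 1 / (S.card : ℝ) *
      ((if G.Adj a b then 1 / (G.degree a : ℝ) else 0) *
        (if G.Adj b c then 1 / (G.degree b : ℝ) else 0)) else 0 else 0 else 0 := by
    intro a b c
    by_cases ha : a ∈ S <;> by_cases hb : b ∈ S <;> by_cases hc : c ∈ S <;>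
      by_cases hab : G.Adj a b <;> by_cases hbc : G.Adj b c <;>
      simp [hab, hbc, walkLaw, Fin.forall_fin_two, Fin.prod_univ_two, ha, hb, hc]
    exact Or.inl rfl
  unfold stayProb
  rw [sum_filter, ← e.symm.sum_comp, Fintype.sum_prod_type]
  simp only [Fintype.sum_prod_type]
  calc _ = ∑ a, ∑ b, ∑ c, if a ∈ S then if b ∈ S then if c ∈ S then 1 / (S.card : ℝ) *
      ((if G.Adj a b then 1 / (G.degree a : ℝ) else 0) *
        (if G.Adj b c then 1 / (G.degree b : ℝ) else 0)) else 0 else 0 else 0 :=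
        sum_congr rfl fun a _ => sum_congr rfl fun b _ => sum_congr rfl fun c _ => key a b c
    _ = _ := by
      simp only [sum_ite_irrel, sum_const_zero, sum_ite_mem, univ_inter, mul_sum]

theorem sum_nbrSum {k : ℕ} {ι : Type*} (S : Finset ι) (x : ι → (Fin 2 → ZMod k) → ℝ)
    (v : Fin 2 → ZMod k) : ∑ i ∈ S, nbrSum (x i) v = nbrSum (fun u => ∑ i ∈ S, x i u) v := by
  simp only [nbrSum, sum_add_distrib]

/-- `P₂(S)` counts the paths of length two inside `S` by their midpoint. -/
theorem stayProb_torus_two {k : ℕ+} (hk : 2 ≤ (k : ℕ)) (S : Finset (Fin 2 → ZMod k)) :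
    stayProb (torus 2 k) 2 S =
      (∑ v, (if v ∈ S then 1 else 0) * nbrSum (fun u => if u ∈ S then (1 : ℝ) else 0) v ^ 2) /
        (16 * S.card) := by
  have hout : ∀ b, ∑ c ∈ S, (nbrSum (fun u => if u = c then (1 : ℝ) else 0) b / 4) =
      nbrSum (fun u => if u ∈ S then (1 : ℝ) else 0) b / 4 := by
    intro b
    rw [← sum_div, sum_nbrSum]
    simp
  have hsymm : ∀ a b : Fin 2 → ZMod k, nbrSum (fun u => if u = b then (1 : ℝ) else 0) a =
      nbrSum (fun u => if u = a then (1 : ℝ) else 0) b := by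
    intro a b
    have h1 : ∀ d, (a + d = b) = (b - d = a) := fun d =>
      propext (eq_sub_iff_add_eq.symm.trans eq_comm)
    have h2 : ∀ d, (a - d = b) = (b + d = a) := fun d =>
      propext (sub_eq_iff_eq_add.trans eq_comm)
    simp only [nbrSum, h1, h2]
    ring
  rw [stayProb_two_eq_sum]
  simp only [torus_two_step hk]
  rw [sum_comm]
  have : ∀ b, ∑ a ∈ S, ∑ c ∈ S, nbrSum (fun u => if u = b then (1 : ℝ) else 0) a / 4 *
      (nbrSum (fun u => if u = c then (1 : ℝ) else 0) b / 4) =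
      nbrSum (fun u => if u ∈ S then (1 : ℝ) else 0) b ^ 2 / 16 := by
    intro b
    simp only [← mul_sum, hout, hsymm _ b]
    rw [← sum_mul, hout]
    ring
  simp only [this, ite_mul, one_mul, zero_mul, sum_ite_mem, univ_inter]
  rw [← sum_div]
  ring

/-! ### Inequalities for two-colourings of the torus -/

section Inequalities

variable {k : ℕ}

theorem sum_nbrSum_univ [NeZero k] (x : (Fin 2 → ZMod k) → ℝ) :
    ∑ v, nbrSum x v = 4 * ∑ v, x v := by
  have h : ∀ d : Fin 2 → ZMod k, ∑ v, x (v + d) = ∑ v, x v :=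
    fun d => Equiv.sum_comp (Equiv.addRight d) x
  have h' : ∀ d : Fin 2 → ZMod k, ∑ v, x (v - d) = ∑ v, x v :=
    fun d => Equiv.sum_comp (Equiv.subRight d) x
  simp only [nbrSum, sum_add_distrib, h, h']
  ring

theorem nbrSum_one_sub (x : (Fin 2 → ZMod k) → ℝ) (v) :
    nbrSum (fun u => 1 - x u) v = 4 - nbrSum x v := by
  simp only [nbrSum]; ring

/-- The weight of a corner path with midpoint colour `a` and end colours `p`, `q`, where blue is `1`
and red is `0`: blue-blue-blue counts `2`, red-red-blue with red midpoint counts `1/2`, and each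
blue-blue edge of the path costs `1/2`, since an edge at a vertex lies on two corners there. -/
noncomputable def cornerWeight (a p q : ℝ) : ℝ :=
  a * (2 * p * q - (p + q) / 2) + (1 - a) * ((p + q - 2 * p * q) / 2)

/-- The four corner paths inside the unit square with diagonals `a d` and `b c` have nonnegative
total weight. -/
theorem cornerWeight_square_nonneg {a b c d : ℝ} (ha : a = 0 ∨ a = 1) (hb : b = 0 ∨ b = 1)
    (hc : c = 0 ∨ c = 1) (hd : d = 0 ∨ d = 1) :
    0 ≤ cornerWeight a b c + cornerWeight b a d + cornerWeight c a d + cornerWeight d b c := by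
  unfold cornerWeight
  rcases ha with rfl | rfl <;> rcases hb with rfl | rfl <;> rcases hc with rfl | rfl <;>
    rcases hd with rfl | rfl <;> norm_num

/-- Dropping the straight paths, the charge of a vertex is at least the weight of the four corner
paths through it. -/
theorem sum_cornerWeight_le {a e w n s : ℝ} (ha : a = 0 ∨ a = 1) (he : e = 0 ∨ e = 1)
    (hw : w = 0 ∨ w = 1) (hn : n = 0 ∨ n = 1) (hs : s = 0 ∨ s = 1) :
    cornerWeight a e n + cornerWeight a e s + cornerWeight a w n + cornerWeight a w s ≤
      a * ((e + w + n + s) * (e + w + n + s - 2)) +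
        (1 - a) * ((e + w + n + s) * (4 - (e + w + n + s)) / 2) := by
  unfold cornerWeight
  rcases ha with rfl | rfl <;> rcases he with rfl | rfl <;> rcases hw with rfl | rfl <;>
    rcases hn with rfl | rfl <;> rcases hs with rfl | rfl <;> norm_num

/-- The corner paths through a vertex and those inside a unit square are two ways to group the
same paths. -/
theorem sum_cornerWeight_nonneg [NeZero k] {x : (Fin 2 → ZMod k) → ℝ}
    (hx : ∀ v, x v = 0 ∨ x v = 1) :
    0 ≤ ∑ v, (cornerWeight (x v) (x (v + ![1, 0])) (x (v + ![0, 1])) +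
      cornerWeight (x v) (x (v + ![1, 0])) (x (v - ![0, 1])) +
      cornerWeight (x v) (x (v - ![1, 0])) (x (v + ![0, 1])) +
      cornerWeight (x v) (x (v - ![1, 0])) (x (v - ![0, 1]))) := by
  have h2 : ∑ v, cornerWeight (x v) (x (v + ![1, 0])) (x (v - ![0, 1])) =
      ∑ v, cornerWeight (x (v + ![0, 1])) (x v) (x (v + ![1, 0] + ![0, 1])) := by
    rw [← Equiv.sum_comp (Equiv.addRight (![0, 1] : Fin 2 → ZMod k))]
    refine sum_congr rfl fun v _ => ?_
    simp only [Equiv.coe_addRight, add_sub_cancel_right, add_right_comm v ![0, 1]]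
    simp only [cornerWeight]; ring
  have h3 : ∑ v, cornerWeight (x v) (x (v - ![1, 0])) (x (v + ![0, 1])) =
      ∑ v, cornerWeight (x (v + ![1, 0])) (x v) (x (v + ![1, 0] + ![0, 1])) := by
    rw [← Equiv.sum_comp (Equiv.addRight (![1, 0] : Fin 2 → ZMod k))]
    refine sum_congr rfl fun v _ => ?_
    simp only [Equiv.coe_addRight, add_sub_cancel_right]
  have h4 : ∑ v, cornerWeight (x v) (x (v - ![1, 0])) (x (v - ![0, 1])) =
      ∑ v, cornerWeight (x (v + ![1, 0] + ![0, 1])) (x (v + ![1, 0])) (x (v + ![0, 1])) := by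
    rw [← Equiv.sum_comp (Equiv.addRight (![1, 0] + ![0, 1] : Fin 2 → ZMod k))]
    refine sum_congr rfl fun v _ => ?_
    have e1 : v + (![1, 0] + ![0, 1]) - ![1, 0] = v + ![0, 1] := by abel
    have e2 : v + (![1, 0] + ![0, 1]) - ![0, 1] = v + ![1, 0] := by abel
    rw [Equiv.coe_addRight, e1, e2]
    simp only [cornerWeight, ← add_assoc]; ring
  rw [sum_add_distrib, sum_add_distrib, sum_add_distrib, h2, h3, h4, ← sum_add_distrib,
    ← sum_add_distrib, ← sum_add_distrib]
  refine sum_nonneg fun v _ => ?_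
  have := cornerWeight_square_nonneg (hx v) (hx (v + ![1, 0])) (hx (v + ![0, 1]))
    (hx (v + ![1, 0] + ![0, 1]))
  linarith

/-- Double counting of the edges between the two colour classes. -/
theorem sum_mul_nbrSum_one_sub [NeZero k] {x : (Fin 2 → ZMod k) → ℝ}
    (hbal : ∑ v, x v = ∑ v, (1 - x v)) :
    ∑ v, (1 - x v) * (4 - nbrSum x v) = ∑ v, x v * nbrSum x v := by
  have h : ∀ v, (1 - x v) * (4 - nbrSum x v) =
      2 * (1 - x v) + 2 * (1 - x v) - nbrSum x v + x v * nbrSum x v := fun v => by ring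
  simp only [h, sum_add_distrib, sum_sub_distrib, sum_nbrSum_univ]
  simp only [sum_sub_distrib] at hbal
  simp only [← mul_sum, sum_sub_distrib, ← hbal]
  ring

theorem nbrSum_mem {x : (Fin 2 → ZMod k) → ℝ} (hx : ∀ v, x v = 0 ∨ x v = 1) (v) :
    nbrSum x v = 0 ∨ nbrSum x v = 1 ∨ nbrSum x v = 2 ∨ nbrSum x v = 3 ∨ nbrSum x v = 4 := by
  unfold nbrSum
  rcases hx (v + ![1, 0]) with h1 | h1 <;> rcases hx (v - ![1, 0]) with h2 | h2 <;>
    rcases hx (v + ![0, 1]) with h3 | h3 <;> rcases hx (v - ![0, 1]) with h4 | h4 <;>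
    simp only [h1, h2, h3, h4] <;> norm_num

/-- The inequality `P₂(R) ≤ 2 P₂(B)` before normalisation, with `x` the indicator of the blue
class. -/
theorem half_sum_sq_le [NeZero k] {x : (Fin 2 → ZMod k) → ℝ} (hx : ∀ v, x v = 0 ∨ x v = 1)
    (hbal : ∑ v, x v = ∑ v, (1 - x v)) :
    ∑ v, (1 - x v) * nbrSum (fun u => 1 - x u) v ^ 2 ≤ 2 * ∑ v, x v * nbrSum x v ^ 2 := by
  have h1 := sum_mul_nbrSum_one_sub hbal
  -- The multiplier `2` of the edge count makes the red charge vanish at `0` and `4` neighbours.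
  have h2 : 0 ≤ ∑ v, (x v * nbrSum x v ^ 2 - 2 * (x v * nbrSum x v) +
      2 * ((1 - x v) * (4 - nbrSum x v)) -
        (1 - x v) * nbrSum (fun u => 1 - x u) v ^ 2 / 2) := by
    refine (sum_cornerWeight_nonneg hx).trans (sum_le_sum fun v _ => ?_)
    refine (sum_cornerWeight_le (hx v) (hx _) (hx _) (hx _) (hx _)).trans (le_of_eq ?_)
    rw [nbrSum_one_sub]; unfold nbrSum; ring
  simp only [sum_sub_distrib, sum_add_distrib, ← mul_sum, ← sum_div] at h2
  linarith

/-- Integrality of the number of neighbours: `(N - j) (N - j - 1) ≥ 0` gives a linear lower bound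
for the squares, for `j = 2` and `j = 3`. -/
theorem linear_le_sum_sq [NeZero k] {x : (Fin 2 → ZMod k) → ℝ} (hx : ∀ v, x v = 0 ∨ x v = 1)
    (hbal : ∑ v, x v = ∑ v, (1 - x v)) {j : ℝ} (hj : j = 2 ∨ j = 3) :
    (2 * j + 1) / 4 * ∑ v, (1 - x v) * nbrSum (fun u => 1 - x u) v ^ 2 - j * (j + 1) * ∑ v, x v ≤
      ∑ v, x v * nbrSum x v ^ 2 := by
  have h1 := sum_mul_nbrSum_one_sub hbal
  -- The square of a red neighbour count is at most four times the count.
  have h2 : ∑ v, (1 - x v) * nbrSum (fun u => 1 - x u) v ^ 2 ≤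
      ∑ v, 4 * ((1 - x v) * (4 - nbrSum x v)) := by
    refine sum_le_sum fun v _ => ?_
    rw [nbrSum_one_sub]
    rcases hx v with h | h <;> rcases nbrSum_mem hx v with h' | h' | h' | h' | h' <;>
      rw [h, h'] <;> norm_num
  have h3 : ∑ v, ((2 * j + 1) * (x v * nbrSum x v) - j * (j + 1) * x v) ≤
      ∑ v, x v * nbrSum x v ^ 2 := by
    refine sum_le_sum fun v _ => ?_
    rcases hj with rfl | rfl <;> rcases hx v with h | h <;>
      rcases nbrSum_mem hx v with h' | h' | h' | h' | h' <;> rw [h, h'] <;> norm_num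
  rw [← mul_sum, h1] at h2
  rw [sum_sub_distrib, ← mul_sum, ← mul_sum] at h3
  rcases hj with rfl | rfl <;> linarith

end Inequalities

/-- The linear inequalities cutting out the achievable region, on one side of the diagonal. -/
structure BelowBounds (x y : ℝ) : Prop where
  half : x / 2 ≤ y
  two_three : 5 / 4 * x - 3 / 8 ≤ y
  three_four : 7 / 4 * x - 3 / 4 ≤ y

theorem IsBalanced.compl {V : Type*} [Fintype V] [DecidableEq V] {R : Finset V}
    (h : IsBalanced R) : IsBalanced Rᶜ := by
  unfold IsBalanced at *; rw [compl_compl, h]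

theorem IsBalanced.two_mul_card {V : Type*} [Fintype V] [DecidableEq V] {R : Finset V}
    (h : IsBalanced R) : 2 * R.card = Fintype.card V := by
  have := R.card_add_card_compl
  unfold IsBalanced at h; omega

theorem stayProb_bounds {k : ℕ+} {R : Finset (Fin 2 → ZMod k)} (hR : IsBalanced R) :
    BelowBounds (stayProb (torus 2 k) 2 R) (stayProb (torus 2 k) 2 Rᶜ) := by
  have hc := hR.two_mul_card
  have hk : 2 ≤ (k : ℕ) := by
    by_contra h
    have h1 : (k : ℕ) = 1 := by have := k.pos; omega
    simp [h1] at hc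
  have hpos : 0 < (R.card : ℝ) := by
    have : 0 < Fintype.card (Fin 2 → ZMod k) := Fintype.card_pos
    exact_mod_cast (by omega : 0 < R.card)
  have hcc : (Rᶜ.card : ℝ) = R.card := by exact_mod_cast hR.symm
  set x : (Fin 2 → ZMod k) → ℝ := fun v => if v ∈ Rᶜ then 1 else 0 with hxdef
  have hx : ∀ v, x v = 0 ∨ x v = 1 := fun v => by
    simp only [hxdef]; split_ifs <;> simp
  have hx' : (fun v => if v ∈ R then (1 : ℝ) else 0) = fun v => 1 - x v := by
    ext v; by_cases h : v ∈ R <;> simp [hxdef, h]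
  have hsx : ∑ v, x v = R.card := by
    rw [← hcc]; simp only [hxdef, sum_boole, filter_mem_eq_inter, univ_inter]
  have hbal : ∑ v, x v = ∑ v, (1 - x v) := by
    rw [hsx, ← hx']; simp only [sum_boole, filter_mem_eq_inter, univ_inter]
  have hP : stayProb (torus 2 k) 2 R =
      (∑ v, (1 - x v) * nbrSum (fun u => 1 - x u) v ^ 2) / (16 * R.card) := by
    rw [stayProb_torus_two hk, hx']
    simp only [congrFun hx']
  have hQ : stayProb (torus 2 k) 2 Rᶜ = (∑ v, x v * nbrSum x v ^ 2) / (16 * R.card) := by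
    rw [stayProb_torus_two hk, hcc]
  have i1 := half_sum_sq_le hx hbal
  have i2 := linear_le_sum_sq hx hbal (Or.inl rfl)
  have i3 := linear_le_sum_sq hx hbal (Or.inr rfl)
  rw [hsx] at i2 i3
  rw [hP, hQ]
  generalize (∑ v, (1 - x v) * nbrSum (fun u => 1 - x u) v ^ 2) = X at *
  generalize (∑ v, x v * nbrSum x v ^ 2) = Y at *
  have hne : 16 * (R.card : ℝ) ≠ 0 := (mul_pos (by norm_num) hpos).ne'
  have hX : X = X / (16 * R.card) * (16 * R.card) := (div_mul_cancel₀ _ hne).symm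
  have hY : Y = Y / (16 * R.card) * (16 * R.card) := (div_mul_cancel₀ _ hne).symm
  generalize X / (16 * (R.card : ℝ)) = X' at *
  generalize Y / (16 * (R.card : ℝ)) = Y' at *
  subst hX hY
  refine ⟨?_, ?_, ?_⟩ <;> refine le_of_mul_le_mul_right ?_ hpos <;> linarith

/-! ### The region in terms of inequalities -/

theorem BelowBounds.of_forall_close {p : ℝ × ℝ}
    (h : ∀ ε : ℝ, 0 < ε → ∃ x y, BelowBounds x y ∧ |x - p.1| < ε ∧ |y - p.2| < ε) :
    BelowBounds p.1 p.2 := by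
  have key : ∀ ε : ℝ, 0 < ε → p.1 / 2 ≤ p.2 + 3 * ε ∧ 5 / 4 * p.1 - 3 / 8 ≤ p.2 + 3 * ε ∧
      7 / 4 * p.1 - 3 / 4 ≤ p.2 + 3 * ε := by
    intro ε hε
    obtain ⟨x, y, hb, h1, h2⟩ := h ε hε
    rw [abs_lt] at h1 h2
    have := hb.half
    have := hb.two_three
    have := hb.three_four
    refine ⟨?_, ?_, ?_⟩ <;> linarith
  refine ⟨?_, ?_, ?_⟩ <;> refine le_of_forall_pos_le_add fun ε hε => ?_ <;>
    have := key (ε / 3) (by positivity)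
  · linarith [this.1]
  · linarith [this.2.1]
  · linarith [this.2.2]

theorem mem_of_barycentric {C : Set (ℝ × ℝ)} (hC : Convex ℝ C) {p q r : ℝ × ℝ} (hp : p ∈ C)
    (hq : q ∈ C) (hr : r ∈ C) {a b c : ℝ} (ha : 0 ≤ a) (hb : 0 ≤ b) (hc : 0 ≤ c)
    (habc : a + b + c = 1) : a • p + b • q + c • r ∈ C := by
  have := hC.sum_mem (t := (univ : Finset (Fin 3))) (w := ![a, b, c]) (z := ![p, q, r])
    (by intro i _; fin_cases i <;> simpa) (by simpa [Fin.sum_univ_three] using habc)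
    (by intro i _; fin_cases i <;> simpa)
  simpa [Fin.sum_univ_three] using this

/-- Below the diagonal the region is the union of the triangles `(0,0), (1/2,1/4), (1,1)` and
`(1/2,1/4), (3/4,9/16), (1,1)`. -/
theorem mem_of_belowBounds {C : Set (ℝ × ℝ)} (hC : Convex ℝ C) (h0 : ((0 : ℝ), (0 : ℝ)) ∈ C)
    (h1 : ((1 / 2 : ℝ), (1 / 4 : ℝ)) ∈ C) (h2 : ((3 / 4 : ℝ), (9 / 16 : ℝ)) ∈ C)
    (h3 : ((1 : ℝ), (1 : ℝ)) ∈ C) {x y : ℝ} (hb : BelowBounds x y) (hxy : y ≤ x) :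
    (x, y) ∈ C := by
  obtain ⟨i1, i2, i3⟩ := hb
  rcases le_total (3 / 2 * x - 1 / 2) y with h | h
  · convert mem_of_barycentric hC h0 h1 h3 (a := 1 + 2 * y - 3 * x) (b := 4 * (x - y))
      (c := 2 * y - x) (by linarith) (by linarith) (by linarith) (by ring) using 1
    ext <;> simp <;> ring
  · convert mem_of_barycentric hC h1 h2 h3 (a := 6 + 8 * y - 14 * x) (b := 24 * x - 16 * y - 8)
      (c := 3 - 10 * x + 8 * y) (by linarith) (by linarith) (by linarith) (by ring) using 1
    ext <;> simp <;> ring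

/-! ### Doubly periodic patterns -/

/-- A two-colouring of the plane lattice, encoded as the indicator function of the red class,
which is invariant under `(k, 0)` and `(0, k)`. -/
structure IsPattern (k : ℕ) (f : ℤ → ℤ → ℝ) : Prop where
  zero_or_one : ∀ i j, f i j = 0 ∨ f i j = 1
  left : ∀ i j, f (i + k) j = f i j
  right : ∀ i j, f i (j + k) = f i j

/-- The average of `F` over the square `{0, …, k - 1}²`. -/
noncomputable def squareAvg (k : ℕ) (F : ℤ → ℤ → ℝ) : ℝ :=
  (∑ i ∈ range k, ∑ j ∈ range k, F i j) / (k : ℝ) ^ 2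

/-- The number of red-red-red paths of length two with midpoint `(i, j)`. -/
def stayWeight (f : ℤ → ℤ → ℝ) (i j : ℤ) : ℝ :=
  f i j * (f (i + 1) j + f (i - 1) j + f i (j + 1) + f i (j - 1)) ^ 2

/-- The pattern with the two colours exchanged. -/
def swapColours (f : ℤ → ℤ → ℝ) : ℤ → ℤ → ℝ := fun i j => 1 - f i j

theorem swapColours_swapColours (f : ℤ → ℤ → ℝ) : swapColours (swapColours f) = f := by
  ext i j; simp [swapColours]

theorem IsPattern.swapColours {k : ℕ} {f : ℤ → ℤ → ℝ} (hf : IsPattern k f) :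
    IsPattern k (swapColours f) where
  zero_or_one i j := by rcases hf.zero_or_one i j with h | h <;> simp [TransitProb.swapColours, h]
  left i j := by simp [TransitProb.swapColours, hf.left]
  right i j := by simp [TransitProb.swapColours, hf.right]

theorem IsPattern.mul {k : ℕ} {f : ℤ → ℤ → ℝ} (hf : IsPattern k f) (m : ℕ) :
    IsPattern (m * k) f where
  zero_or_one := hf.zero_or_one
  left i j := by
    have h : Function.Periodic (fun i => f i j) (k : ℤ) := fun i => hf.left i j
    simpa using h.nat_mul m i
  right i j := by
    have h : Function.Periodic (fun j => f i j) (k : ℤ) := fun j => hf.right i j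
    simpa using h.nat_mul m j

theorem IsPattern.stayWeight_left {k : ℕ} {f : ℤ → ℤ → ℝ} (hf : IsPattern k f) (i j : ℤ) :
    stayWeight f (i + k) j = stayWeight f i j := by
  simp only [stayWeight, hf.left, add_right_comm i (k : ℤ), add_sub_right_comm i (k : ℤ)]

theorem IsPattern.stayWeight_right {k : ℕ} {f : ℤ → ℤ → ℝ} (hf : IsPattern k f) (i j : ℤ) :
    stayWeight f i (j + k) = stayWeight f i j := by
  simp only [stayWeight, hf.right, add_right_comm j (k : ℤ), add_sub_right_comm j (k : ℤ)]

theorem IsPattern.abs_sub_le {k l : ℕ} {f g : ℤ → ℤ → ℝ} (hf : IsPattern k f)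
    (hg : IsPattern l g) (i j : ℤ) : |stayWeight f i j - stayWeight g i j| ≤ 16 := by
  have key : ∀ {k : ℕ} {f : ℤ → ℤ → ℝ}, IsPattern k f →
      0 ≤ stayWeight f i j ∧ stayWeight f i j ≤ 16 := by
    intro k f hf
    unfold stayWeight
    rcases hf.zero_or_one i j with h0 | h0 <;> rcases hf.zero_or_one (i + 1) j with h1 | h1 <;>
      rcases hf.zero_or_one (i - 1) j with h2 | h2 <;>
      rcases hf.zero_or_one i (j + 1) with h3 | h3 <;>
      rcases hf.zero_or_one i (j - 1) with h4 | h4 <;>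
      rw [h0, h1, h2, h3, h4] <;> norm_num
  have h1 := key hf
  have h2 := key hg
  rw [abs_le]
  constructor <;> linarith [h1.1, h1.2, h2.1, h2.2]

theorem sum_range_mul_of_periodic {k : ℕ} {g : ℤ → ℝ} (hg : ∀ i, g (i + k) = g i) (m : ℕ) :
    ∑ i ∈ range (m * k), g i = m * ∑ i ∈ range k, g i := by
  have h : Function.Periodic g (k : ℤ) := hg
  induction m with
  | zero => simp
  | succ m ih =>
    rw [add_mul, one_mul, sum_range_add, ih]
    have : ∀ x : ℕ, g ((m * k + x : ℕ) : ℤ) = g x := fun x => by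
      have := h.nat_mul m x
      rw [add_comm] at this
      simpa using this
    simp only [this]
    push_cast; ring

theorem squareAvg_mul {k : ℕ} {F : ℤ → ℤ → ℝ} (hl : ∀ i j, F (i + k) j = F i j)
    (hr : ∀ i j, F i (j + k) = F i j) {m : ℕ} (hm : 0 < m) :
    squareAvg (m * k) F = squareAvg k F := by
  unfold squareAvg
  have h1 : ∀ i : ℤ, ∑ j ∈ range (m * k), F i j = m * ∑ j ∈ range k, F i j :=
    fun i => sum_range_mul_of_periodic (hr i) m
  have h2 := sum_range_mul_of_periodic (k := k) (g := fun i : ℤ => ∑ j ∈ range k, F i j)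
    (fun i => by simp only [hl]) m
  simp only [h1, ← mul_sum, h2]
  have : (m : ℝ) ≠ 0 := by positivity
  push_cast
  rw [mul_pow, ← mul_assoc, ← pow_two, mul_div_mul_left _ _ (pow_ne_zero 2 this)]

/-- The pattern of period `2 M` that alternates vertical strips of width `M` of `f` and `g`. -/
noncomputable def strip (M : ℕ) (f g : ℤ → ℤ → ℝ) : ℤ → ℤ → ℝ :=
  fun i j => if i % (2 * M) < M then f i j else g i j

theorem strip_of_lt {M : ℕ} {f g : ℤ → ℤ → ℝ} {i : ℤ} (j : ℤ) (h0 : 0 ≤ i) (h : i < M) :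
    strip M f g i j = f i j := by
  have : i % (2 * M) = i := Int.emod_eq_of_lt h0 (by omega)
  rw [strip, if_pos (by omega)]

theorem strip_of_le {M : ℕ} {f g : ℤ → ℤ → ℝ} {i : ℤ} (j : ℤ) (h0 : M ≤ i) (h : i < 2 * M) :
    strip M f g i j = g i j := by
  have : i % (2 * M) = i := Int.emod_eq_of_lt (by omega) h
  rw [strip, if_neg (by omega)]

theorem swapColours_strip (M : ℕ) (f g : ℤ → ℤ → ℝ) :
    swapColours (strip M f g) = strip M (swapColours f) (swapColours g) := by
  ext i j
  simp only [swapColours, strip]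
  split_ifs <;> rfl

theorem IsPattern.strip {M : ℕ} {f g : ℤ → ℤ → ℝ} (hf : IsPattern M f) (hg : IsPattern M g) :
    IsPattern (2 * M) (strip M f g) where
  zero_or_one i j := by
    unfold TransitProb.strip; split_ifs
    exacts [hf.zero_or_one i j, hg.zero_or_one i j]
  left i j := by
    have h1 := (hf.mul 2).left i j
    have h2 := (hg.mul 2).left i j
    push_cast at h1 h2 ⊢
    simp only [TransitProb.strip, Int.add_emod_right, h1, h2]
  right i j := by
    have h1 := (hf.mul 2).right i j
    have h2 := (hg.mul 2).right i j
    simp only [TransitProb.strip, h1, h2]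

theorem half_squareAvg_add {M : ℕ} {F G : ℤ → ℤ → ℝ} (hF : ∀ i j, F i (j + M) = F i j)
    (hG : ∀ i j, G i (j + M) = G i j) (hG' : ∀ i j, G (i + M) j = G i j) :
    (squareAvg M F + squareAvg M G) / 2 =
      (∑ i ∈ range M, ∑ j ∈ range (2 * M), F i j +
        ∑ i ∈ range M, ∑ j ∈ range (2 * M), G ((M + i : ℕ) : ℤ) j) / ((2 * M : ℕ) : ℝ) ^ 2 := by
  have h1 : ∀ i : ℤ, ∑ j ∈ range (2 * M), F i j = (2 : ℕ) * ∑ j ∈ range M, F i j :=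
    fun i => sum_range_mul_of_periodic (hF i) 2
  have h2 : ∀ i : ℤ, ∑ j ∈ range (2 * M), G i j = (2 : ℕ) * ∑ j ∈ range M, G i j :=
    fun i => sum_range_mul_of_periodic (hG i) 2
  have h3 : ∀ (i : ℕ) (j : ℤ), G ((M + i : ℕ) : ℤ) j = G i j := fun i j => by
    rw [← hG' i j]; congr 1; push_cast; ring
  simp only [h1, h2, h3, ← mul_sum]
  unfold squareAvg
  push_cast
  ring

theorem squareAvg_strip {M : ℕ} {f g : ℤ → ℤ → ℝ} (hf : IsPattern M f) (hg : IsPattern M g) :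
    squareAvg (2 * M) (strip M f g) = (squareAvg M f + squareAvg M g) / 2 := by
  rw [half_squareAvg_add hf.right hg.right hg.left]
  unfold squareAvg
  congr 1
  rw [two_mul, sum_range_add]
  congr 1
  · refine sum_congr rfl fun i hi => sum_congr rfl fun j _ => strip_of_lt _ (by omega) ?_
    have := mem_range.1 hi; omega
  · refine sum_congr rfl fun i hi => sum_congr rfl fun j _ => strip_of_le _ ?_ ?_ <;>
    · have := mem_range.1 hi; push_cast; omega

/-- Two functions that differ at the ends of `range M` only have nearby sums. -/
theorem abs_sum_sub_sum_le {M : ℕ} {a b : ℕ → ℝ} {C : ℝ} (hC : 0 ≤ C)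
    (hab : ∀ i < M, |a i - b i| ≤ C) (h : ∀ i, 0 < i → i + 1 < M → a i = b i) :
    |∑ i ∈ range M, a i - ∑ i ∈ range M, b i| ≤ 2 * C := by
  rw [← sum_sub_distrib]
  calc |∑ i ∈ range M, (a i - b i)| ≤ ∑ i ∈ range M, |a i - b i| := abs_sum_le_sum_abs _ _
    _ ≤ ∑ i ∈ range M, ((if i = 0 then C else 0) + if i = M - 1 then C else 0) := by
      refine sum_le_sum fun i hi => ?_
      have hi' := mem_range.1 hi
      by_cases h0 : i = 0
      · rw [if_pos h0]
        have := hab i hi'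
        split_ifs <;> linarith
      · by_cases h1 : i = M - 1
        · rw [if_pos h1, if_neg h0]
          linarith [hab i hi']
        · rw [h i (by omega) (by omega)]
          simp [h0, h1]
    _ ≤ 2 * C := by
      rw [sum_add_distrib, sum_ite_eq', sum_ite_eq']
      split_ifs <;> linarith

/-- Only the columns next to the boundary of a strip see both patterns. -/
theorem abs_squareAvg_stayWeight_strip_sub_le {M : ℕ} (hM : 0 < M) {f g : ℤ → ℤ → ℝ}
    (hf : IsPattern M f) (hg : IsPattern M g) :
    |squareAvg (2 * M) (stayWeight (strip M f g)) -
      (squareAvg M (stayWeight f) + squareAvg M (stayWeight g)) / 2| ≤ 32 / M := by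
  rw [half_squareAvg_add hf.stayWeight_right hg.stayWeight_right hg.stayWeight_left]
  have hs := hf.strip hg
  have col : ∀ {k : ℕ} {f' : ℤ → ℤ → ℝ} (i : ℤ), IsPattern k f' →
      |∑ j ∈ range (2 * M), stayWeight (strip M f g) i j -
        ∑ j ∈ range (2 * M), stayWeight f' i j| ≤ 32 * M := by
    intro k f' i hf'
    rw [← sum_sub_distrib]
    refine (abs_sum_le_sum_abs _ _).trans ?_
    refine (sum_le_sum fun (j : ℕ) _ => hs.abs_sub_le hf' i j).trans (le_of_eq ?_)
    rw [sum_const, card_range, nsmul_eq_mul]; push_cast; ring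
  have e1 := abs_sum_sub_sum_le (M := M) (C := 32 * M)
    (a := fun i => ∑ j ∈ range (2 * M), stayWeight (strip M f g) i j)
    (b := fun i => ∑ j ∈ range (2 * M), stayWeight f i j) (by positivity)
    (fun i _ => col i hf) (fun i h0 h1 => by
      refine sum_congr rfl fun j _ => ?_
      unfold stayWeight
      simp only [strip_of_lt (M := M) (f := f) (g := g) (i := i) _ (by omega) (by omega),
        strip_of_lt (M := M) (f := f) (g := g) (i := i + 1) _ (by omega) (by omega),
        strip_of_lt (M := M) (f := f) (g := g) (i := i - 1) _ (by omega) (by omega)])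
  have e2 := abs_sum_sub_sum_le (M := M) (C := 32 * M)
    (a := fun i => ∑ j ∈ range (2 * M), stayWeight (strip M f g) ((M + i : ℕ) : ℤ) j)
    (b := fun i => ∑ j ∈ range (2 * M), stayWeight g ((M + i : ℕ) : ℤ) j) (by positivity)
    (fun i _ => col _ hg) (fun i h0 h1 => by
      refine sum_congr rfl fun j _ => ?_
      unfold stayWeight
      simp only [strip_of_le (M := M) (f := f) (g := g) (i := (M + i : ℕ)) _
          (by push_cast; omega) (by push_cast; omega),
        strip_of_le (M := M) (f := f) (g := g) (i := (M + i : ℕ) + 1) _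
          (by push_cast; omega) (by push_cast; omega),
        strip_of_le (M := M) (f := f) (g := g) (i := (M + i : ℕ) - 1) _
          (by push_cast; omega) (by push_cast; omega)])
  have hM' : (0 : ℝ) < M := by exact_mod_cast hM
  unfold squareAvg
  rw [← sub_div, abs_div, abs_of_pos (by positivity : (0 : ℝ) < ((2 * M : ℕ) : ℝ) ^ 2),
    div_le_div_iff₀ (by positivity) hM']
  rw [abs_le] at e1 e2
  have hsplit : ∑ i ∈ range (2 * M), ∑ j ∈ range (2 * M), stayWeight (strip M f g) i j =
      ∑ i ∈ range M, ∑ j ∈ range (2 * M), stayWeight (strip M f g) i j +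
        ∑ i ∈ range M, ∑ j ∈ range (2 * M), stayWeight (strip M f g) ((M + i : ℕ) : ℤ) j := by
    rw [two_mul M, sum_range_add]
  rw [hsplit]
  have : |(∑ i ∈ range M, ∑ j ∈ range (2 * M), stayWeight (strip M f g) i j +
        ∑ i ∈ range M, ∑ j ∈ range (2 * M), stayWeight (strip M f g) ((M + i : ℕ) : ℤ) j) -
      (∑ i ∈ range M, ∑ j ∈ range (2 * M), stayWeight f i j +
        ∑ i ∈ range M, ∑ j ∈ range (2 * M), stayWeight g ((M + i : ℕ) : ℤ) j)| ≤ 128 * M := by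
    rw [abs_le]
    constructor <;> linarith [e1.1, e1.2, e2.1, e2.2]
  refine (mul_le_mul_of_nonneg_right this hM'.le).trans (le_of_eq ?_)
  push_cast; ring

/-! ### Asymptotic profiles -/

/-- The limits of `(red density, red weight, blue weight)` along periodic patterns, where the
density is required to be exact. -/
def profileSet : Set (ℝ × ℝ × ℝ) :=
  {p | ∀ ε : ℝ, 0 < ε → ∃ (k : ℕ) (f : ℤ → ℤ → ℝ), 0 < k ∧ IsPattern k f ∧ squareAvg k f = p.1 ∧
    |squareAvg k (stayWeight f) - p.2.1| < ε ∧
    |squareAvg k (stayWeight (swapColours f)) - p.2.2| < ε}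

theorem profileSet_swapColours {r a b : ℝ} (h : (r, a, b) ∈ profileSet) :
    (1 - r, b, a) ∈ profileSet := by
  intro ε hε
  obtain ⟨k, f, hk, hf, hr, ha, hb⟩ := h ε hε
  refine ⟨k, swapColours f, hk, hf.swapColours, ?_, hb, by rwa [swapColours_swapColours]⟩
  have hk' : (k : ℝ) ≠ 0 := by positivity
  simp only at hr
  rw [← hr]
  simp only [squareAvg, swapColours, sum_sub_distrib, sum_const, card_range, nsmul_eq_mul]
  field_simp

/-- Profiles are averaged by putting two patterns side by side in wide strips. -/
theorem profileSet_midpoint {r a b r' a' b' : ℝ} (h : (r, a, b) ∈ profileSet)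
    (h' : (r', a', b') ∈ profileSet) :
    ((r + r') / 2, (a + a') / 2, (b + b') / 2) ∈ profileSet := by
  intro ε hε
  obtain ⟨k, f, hk, hf, hr, ha, hb⟩ := h (ε / 2) (by positivity)
  obtain ⟨l, g, hl, hg, hr', ha', hb'⟩ := h' (ε / 2) (by positivity)
  obtain ⟨n, hn⟩ := exists_nat_gt (64 / ε)
  have hn0 : 0 < n := by
    have : (0 : ℝ) < n := lt_trans (by positivity) hn
    exact_mod_cast this
  -- Both patterns have period `n l k`, and `n` makes the boundary error small.
  have hM : 0 < n * l * k := by positivity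
  have hF : IsPattern (n * l * k) f := hf.mul _
  have hG : IsPattern (n * l * k) g := by
    have := hg.mul (n * k)
    rwa [mul_right_comm] at this
  have af : squareAvg (n * l * k) f = squareAvg k f :=
    squareAvg_mul hf.left hf.right (by positivity)
  have ag : squareAvg (n * l * k) g = squareAvg l g := by
    rw [mul_right_comm]; exact squareAvg_mul hg.left hg.right (by positivity)
  have wf : ∀ {f}, IsPattern k f →
      squareAvg (n * l * k) (stayWeight f) = squareAvg k (stayWeight f) :=
    fun hf => squareAvg_mul hf.stayWeight_left hf.stayWeight_right (by positivity)
  have wg : ∀ {g}, IsPattern l g →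
      squareAvg (n * l * k) (stayWeight g) = squareAvg l (stayWeight g) := fun hg => by
    rw [mul_right_comm]
    exact squareAvg_mul hg.stayWeight_left hg.stayWeight_right (by positivity)
  have hsmall : 32 / ((n * l * k : ℕ) : ℝ) < ε / 2 := by
    rw [div_lt_iff₀ (by positivity)] at hn
    rw [div_lt_div_iff₀ (by positivity) (by positivity)]
    have h1 : (1 : ℝ) ≤ ((l * k : ℕ) : ℝ) := by exact_mod_cast Nat.mul_pos hl hk
    have h2 : (n : ℝ) ≤ ((n * l * k : ℕ) : ℝ) := by
      rw [mul_assoc, Nat.cast_mul]; exact le_mul_of_one_le_right (by positivity) h1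
    nlinarith
  have s1 := abs_squareAvg_stayWeight_strip_sub_le hM hF hG
  have s2 := abs_squareAvg_stayWeight_strip_sub_le hM hF.swapColours hG.swapColours
  rw [wf hf, wg hg] at s1
  rw [wf hf.swapColours, wg hg.swapColours] at s2
  simp only at hr hr' ha ha' hb hb'
  rw [abs_lt] at ha hb ha' hb'
  rw [abs_le] at s1 s2
  refine ⟨2 * (n * l * k), strip (n * l * k) f g, by positivity, hF.strip hG, ?_, ?_, ?_⟩
  · rw [squareAvg_strip hF hG, af, ag, hr, hr']
  · simp only
    rw [abs_lt]
    constructor <;> linarith [s1.1, s1.2, ha.1, ha.2, ha'.1, ha'.2]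
  · simp only
    rw [swapColours_strip, abs_lt]
    constructor <;> linarith [s2.1, s2.2, hb.1, hb.2, hb'.1, hb'.2]

theorem mem_profileSet {k : ℕ} {f : ℤ → ℤ → ℝ} (hk : 0 < k) (hf : IsPattern k f) :
    (squareAvg k f, squareAvg k (stayWeight f), squareAvg k (stayWeight (swapColours f))) ∈
      profileSet := fun ε hε => ⟨k, f, hk, hf, rfl, by simpa, by simpa⟩

/-- The pattern whose red points are those with `i + c j ≡ 0` modulo `d`. -/
noncomputable def latticePattern (c d : ℤ) : ℤ → ℤ → ℝ :=
  fun i j => if (i + c * j) % d = 0 then 1 else 0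

theorem isPattern_latticePattern (c : ℤ) (d : ℕ) : IsPattern d (latticePattern c d) where
  zero_or_one i j := by unfold latticePattern; split_ifs <;> simp
  left i j := by
    unfold latticePattern
    rw [add_right_comm, Int.add_emod_right]
  right i j := by
    unfold latticePattern
    rw [mul_add, ← add_assoc, Int.add_mul_emod_self_right]

theorem full_mem_profileSet : (1, 16, 0) ∈ profileSet := by
  convert mem_profileSet one_pos (isPattern_latticePattern 0 1) using 3 <;>
    norm_num [squareAvg, stayWeight, swapColours, latticePattern]

theorem checkerboard_mem_profileSet : (1 / 2, 0, 0) ∈ profileSet := by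
  convert mem_profileSet (by norm_num : 0 < 2) (isPattern_latticePattern 1 2) using 3 <;>
    simp only [squareAvg, sum_range_succ, sum_range_zero, stayWeight, swapColours, latticePattern] <;>
    norm_num

theorem third_mem_profileSet : (1 / 3, 0, 8 / 3) ∈ profileSet := by
  convert mem_profileSet (by norm_num : 0 < 3) (isPattern_latticePattern 1 3) using 3 <;>
    simp only [squareAvg, sum_range_succ, sum_range_zero, stayWeight, swapColours, latticePattern] <;>
    norm_num

theorem fifth_mem_profileSet : (1 / 5, 0, 36 / 5) ∈ profileSet := by
  convert mem_profileSet (by norm_num : 0 < 5) (isPattern_latticePattern 2 5) using 3 <;>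
    simp only [squareAvg, sum_range_succ, sum_range_zero, stayWeight, swapColours, latticePattern] <;>
    norm_num

/-! ### From patterns to balanced colourings -/

/-- Sums over the torus are sums over the fundamental square of representatives. -/
theorem sum_torus_eq_sum_range {k : ℕ} [NeZero k] (F : ℤ → ℤ → ℝ) :
    ∑ v : Fin 2 → ZMod k, F (v 0).val (v 1).val = ∑ i ∈ range k, ∑ j ∈ range k, F i j := by
  have h1 : ∀ g : ℕ → ℝ, ∑ a : ZMod k, g a.val = ∑ i ∈ range k, g i := by
    intro g
    obtain _ | n := k
    · exact absurd rfl (NeZero.ne 0)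
    · exact Fin.sum_univ_eq_sum_range g (n + 1)
  rw [← (finTwoArrowEquiv (ZMod k)).symm.sum_comp, Fintype.sum_prod_type]
  simp only [finTwoArrowEquiv_symm_apply, Matrix.cons_val_zero, Matrix.cons_val_one]
  rw [← h1 fun i => ∑ j ∈ range k, F i j]
  exact sum_congr rfl fun a _ => h1 fun j => F a.val j

theorem eq_of_intCast_zmod_eq {k : ℕ} {g : ℤ → ℝ} (hg : ∀ i, g (i + k) = g i) {i j : ℤ}
    (h : (i : ZMod k) = j) : g i = g j := by
  obtain ⟨c, hc⟩ := (ZMod.intCast_eq_intCast_iff_dvd_sub i j k).1 h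
  have := (show Function.Periodic g (k : ℤ) from hg).int_mul c i
  rw [Int.cast_id] at this
  rw [← this]; congr 1; linarith [mul_comm (k : ℤ) c]

theorem IsPattern.nbrSum_eq {k : ℕ} [NeZero k] {f : ℤ → ℤ → ℝ} (hf : IsPattern k f)
    (v : Fin 2 → ZMod k) :
    nbrSum (fun u => f (u 0).val (u 1).val) v =
      f ((v 0).val + 1) (v 1).val + f ((v 0).val - 1) (v 1).val + f (v 0).val ((v 1).val + 1) +
        f (v 0).val ((v 1).val - 1) := by
  have hl : ∀ {i i' : ℤ} (j : ℤ), (i : ZMod k) = i' → f i j = f i' j :=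
    fun j h => eq_of_intCast_zmod_eq (g := fun i => f i j) (fun i => hf.left i j) h
  have hr : ∀ {j j' : ℤ} (i : ℤ), (j : ZMod k) = j' → f i j = f i j' :=
    fun i h => eq_of_intCast_zmod_eq (g := fun j => f i j) (fun j => hf.right i j) h
  simp only [nbrSum, Pi.add_apply, Pi.sub_apply, Matrix.cons_val_zero, Matrix.cons_val_one,
    add_zero, sub_zero]
  congr 1
  · congr 1
    · congr 1
      · exact hl _ (by simp)
      · exact hl _ (by simp)
    · exact hr _ (by simp)
  · exact hr _ (by simp)

/-- A periodic pattern of density one half descends to a balanced colouring of the torus. -/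
theorem IsPattern.exists_isBalanced {k : ℕ+} {f : ℤ → ℤ → ℝ} (hf : IsPattern k f)
    (hd : squareAvg k f = 1 / 2) : ∃ R : Finset (Fin 2 → ZMod k), IsBalanced R ∧
      stayProb (torus 2 k) 2 R = squareAvg k (stayWeight f) / 8 ∧
      stayProb (torus 2 k) 2 Rᶜ = squareAvg k (stayWeight (TransitProb.swapColours f)) / 8 := by
  classical
  have hk : 0 < (k : ℕ) := k.pos
  -- A single vertex has density `0` or `1`.
  have hk2 : 2 ≤ (k : ℕ) := by
    by_contra h
    have h1 : (k : ℕ) = 1 := by omega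
    rw [h1] at hd
    rcases hf.zero_or_one 0 0 with h0 | h0 <;> norm_num [squareAvg, h0] at hd
  have hkr : (k : ℝ) ≠ 0 := by positivity
  let R : Finset (Fin 2 → ZMod k) := univ.filter fun v => f (v 0).val (v 1).val = 1
  have hR : ∀ v : Fin 2 → ZMod k, (if v ∈ R then (1 : ℝ) else 0) = f (v 0).val (v 1).val := by
    intro v
    rcases hf.zero_or_one (v 0).val (v 1).val with h | h <;> simp only [R, mem_filter_univ, h] <;>
      norm_num
  have hRc : ∀ v : Fin 2 → ZMod k,
      (if v ∈ Rᶜ then (1 : ℝ) else 0) = TransitProb.swapColours f (v 0).val (v 1).val := by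
    intro v
    rw [TransitProb.swapColours, ← hR v]
    by_cases h : v ∈ R <;> simp [h]
  have hcard : (R.card : ℝ) = (k : ℝ) ^ 2 / 2 := by
    have h1 : (R.card : ℝ) = ∑ v : Fin 2 → ZMod k, if v ∈ R then (1 : ℝ) else 0 := by simp
    rw [h1, sum_congr rfl fun v _ => hR v, sum_torus_eq_sum_range]
    unfold squareAvg at hd
    field_simp at hd
    linarith
  have htot : (R.card : ℝ) + (Rᶜ.card : ℝ) = (k : ℝ) ^ 2 := by
    have := R.card_add_card_compl
    rw [Fintype.card_fun, ZMod.card, Fintype.card_fin] at this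
    exact_mod_cast this
  have hcardc : (Rᶜ.card : ℝ) = (k : ℝ) ^ 2 / 2 := by linarith
  have main : ∀ {S : Finset (Fin 2 → ZMod k)} {g : ℤ → ℤ → ℝ}, IsPattern k g →
      (S.card : ℝ) = (k : ℝ) ^ 2 / 2 →
      (∀ v : Fin 2 → ZMod k, (if v ∈ S then (1 : ℝ) else 0) = g (v 0).val (v 1).val) →
      stayProb (torus 2 k) 2 S = squareAvg k (stayWeight g) / 8 := by
    intro S g hg hS hv
    rw [stayProb_torus_two hk2]
    rw [hS, squareAvg, ← sum_torus_eq_sum_range]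
    simp only [hv, hg.nbrSum_eq, stayWeight]
    field_simp
    ring
  refine ⟨R, ?_, main hf hcard hR, main hf.swapColours hcardc hRc⟩
  have : (R.card : ℝ) = (Rᶜ.card : ℝ) := by rw [hcard, hcardc]
  exact_mod_cast this

/-- The points achieved by periodic patterns of red density one half. At this density
`P₂ = (average weight) / (16 · 1/2)`, whence the factor `8`. -/
def balancedSet : Set (ℝ × ℝ) := {p | (1 / 2, 8 * p.1, 8 * p.2) ∈ profileSet}

theorem balancedSet_subset : balancedSet ⊆ achievableSet (torus 2) := by
  intro p hp ε hε
  obtain ⟨k, f, hk, hf, hr, ha, hb⟩ := hp ε hε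
  obtain ⟨R, hR, h1, h2⟩ := IsPattern.exists_isBalanced (k := ⟨k, hk⟩) hf hr
  refine ⟨⟨k, hk⟩, R, hR, ?_, ?_⟩
  · rw [h1, PNat.mk_coe]
    simp only [abs_lt] at ha ⊢
    constructor <;> linarith [ha.1, ha.2]
  · rw [h2, PNat.mk_coe]
    simp only [abs_lt] at hb ⊢
    constructor <;> linarith [hb.1, hb.2]

theorem isClosed_balancedSet : IsClosed balancedSet := by
  refine isClosed_of_closure_subset fun p hp ε hε => ?_
  obtain ⟨q, hq, hpq⟩ := Metric.mem_closure_iff.1 hp (ε / 16) (by positivity)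
  obtain ⟨k, f, hk, hf, hr, ha, hb⟩ := hq (ε / 2) (by positivity)
  rw [Prod.dist_eq, max_lt_iff, Real.dist_eq, Real.dist_eq] at hpq
  obtain ⟨d1, d2⟩ := hpq
  refine ⟨k, f, hk, hf, hr, ?_, ?_⟩
  · simp only [abs_lt] at *
    constructor <;> linarith [ha.1, ha.2, d1.1, d1.2]
  · simp only [abs_lt] at *
    constructor <;> linarith [hb.1, hb.2, d2.1, d2.2]

/-- A closed set containing all midpoints is convex: a gap in a segment would have its own
midpoint in the set. -/
theorem convex_of_isClosed_of_midpoint {E : Type*} [AddCommGroup E] [Module ℝ E]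
    [TopologicalSpace E] [ContinuousAdd E] [ContinuousSMul ℝ E] {s : Set E} (hs : IsClosed s)
    (h : ∀ x ∈ s, ∀ y ∈ s, (1 / 2 : ℝ) • (x + y) ∈ s) : Convex ℝ s := by
  rw [convex_iff_segment_subset]
  intro x hx y hy
  rw [segment_eq_image]
  rintro _ ⟨t, ht, rfl⟩
  let φ : ℝ → E := fun t => (1 - t) • x + t • y
  have hφ : Continuous φ := by fun_prop
  change φ t ∈ s
  have hT : IsClosed (φ ⁻¹' s) := hs.preimage hφ
  have hmid : ∀ a ∈ φ ⁻¹' s, ∀ b ∈ φ ⁻¹' s, (a + b) / 2 ∈ φ ⁻¹' s := by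
    intro a ha b hb
    have := h _ ha _ hb
    have e : φ ((a + b) / 2) = (1 / 2 : ℝ) • (φ a + φ b) := by
      simp only [φ]; module
    rw [Set.mem_preimage, e]; exact this
  by_contra hts
  have h0 : (0 : ℝ) ∈ φ ⁻¹' s ∩ Set.Icc 0 t := ⟨by simpa [φ] using hx, le_rfl, ht.1⟩
  have h1 : (1 : ℝ) ∈ φ ⁻¹' s ∩ Set.Icc t 1 := ⟨by simpa [φ] using hy, ht.2, le_rfl⟩
  obtain ⟨a, ⟨ha, ha'⟩, hamax⟩ := (isCompact_Icc.inter_left hT).exists_isGreatest ⟨0, h0⟩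
  obtain ⟨b, ⟨hb, hb'⟩, hbmin⟩ := (isCompact_Icc.inter_left hT).exists_isLeast ⟨1, h1⟩
  have hat : a < t := lt_of_le_of_ne ha'.2 fun h => hts (h ▸ ha)
  have htb : t < b := lt_of_le_of_ne hb'.1 fun h => hts (h ▸ hb)
  have hm := hmid a ha b hb
  rcases le_total ((a + b) / 2) t with hle | hle
  · have := hamax ⟨hm, by linarith [ha'.1], hle⟩
    linarith
  · have := hbmin ⟨hm, hle, by linarith [hb'.2]⟩
    linarith

theorem convex_balancedSet : Convex ℝ balancedSet := by
  refine convex_of_isClosed_of_midpoint isClosed_balancedSet fun p hp q hq => ?_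
  have := profileSet_midpoint hp hq
  unfold balancedSet
  rw [Set.mem_ofPred_eq]
  convert this using 3 <;> simp <;> ring

theorem swap_mem_balancedSet {p : ℝ × ℝ} (hp : p ∈ balancedSet) : p.swap ∈ balancedSet := by
  have := profileSet_swapColours hp
  norm_num at this
  exact this

/-- A quarter of the torus is red, and the remaining three quarters carry the pattern modulo
three. -/
theorem half_quarter_mem : ((1 / 2 : ℝ), (1 / 4 : ℝ)) ∈ balancedSet := by
  have := profileSet_midpoint (profileSet_midpoint full_mem_profileSet third_mem_profileSet)
    third_mem_profileSet
  unfold balancedSet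
  rw [Set.mem_ofPred_eq]
  convert this using 3 <;> norm_num

/-- Three eighths of the torus are red, and the remaining five eighths carry the pattern modulo
five. -/
theorem three_quarters_mem : ((3 / 4 : ℝ), (9 / 16 : ℝ)) ∈ balancedSet := by
  have h := profileSet_midpoint full_mem_profileSet fifth_mem_profileSet
  -- `3/8` is the mean of `1/4` and `1/2`.
  have := profileSet_midpoint (profileSet_midpoint h fifth_mem_profileSet) h
  unfold balancedSet
  rw [Set.mem_ofPred_eq]
  convert this using 3 <;> norm_num

theorem one_one_mem : ((1 : ℝ), (1 : ℝ)) ∈ balancedSet := by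
  have := profileSet_midpoint full_mem_profileSet (profileSet_swapColours full_mem_profileSet)
  unfold balancedSet
  rw [Set.mem_ofPred_eq]
  convert this using 3 <;> norm_num

theorem zero_zero_mem : ((0 : ℝ), (0 : ℝ)) ∈ balancedSet := by
  unfold balancedSet
  rw [Set.mem_ofPred_eq]
  convert checkerboard_mem_profileSet using 3 <;> norm_num

/-! ### The achievable set of the two-dimensional torus -/

theorem belowBounds_of_mem_achievableSet {p : ℝ × ℝ} (hp : p ∈ achievableSet (torus 2)) :
    BelowBounds p.1 p.2 ∧ BelowBounds p.2 p.1 := by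
  constructor
  · refine BelowBounds.of_forall_close fun ε hε => ?_
    obtain ⟨k, R, hR, h1, h2⟩ := hp ε hε
    exact ⟨_, _, stayProb_bounds hR, h1, h2⟩
  · refine BelowBounds.of_forall_close (p := (p.2, p.1)) fun ε hε => ?_
    obtain ⟨k, R, hR, h1, h2⟩ := hp ε hε
    refine ⟨_, _, stayProb_bounds hR.compl, h2, ?_⟩
    rwa [compl_compl]

theorem achievableSet_torus_two : achievableSet (torus 2) =
    symmHull {((0 : ℝ), (0 : ℝ)), ((1 / 2 : ℝ), (1 / 4 : ℝ)), ((3 / 4 : ℝ), (9 / 16 : ℝ)),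
      ((1 : ℝ), (1 : ℝ))} := by
  refine Set.Subset.antisymm ?_ ?_
  · rintro ⟨x, y⟩ hp
    obtain ⟨b1, b2⟩ := belowBounds_of_mem_achievableSet hp
    have hC : ∀ S : Set (ℝ × ℝ), Convex ℝ (symmHull S) := fun S => convex_convexHull ℝ _
    have hsub : ∀ {S : Set (ℝ × ℝ)} {p}, p ∈ S → p ∈ symmHull S :=
      fun h => subset_convexHull ℝ _ (Or.inl h)
    have hswap : ∀ {S : Set (ℝ × ℝ)} {p}, p ∈ S → p ∈ Prod.swap ⁻¹' symmHull S :=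
      fun {S p} h => subset_convexHull ℝ _ (Or.inr ⟨p, h, rfl⟩)
    rcases le_total y x with hxy | hxy
    · exact mem_of_belowBounds (hC _) (hsub (by simp)) (hsub (by simp)) (hsub (by simp))
        (hsub (by simp)) b1 hxy
    · exact mem_of_belowBounds (C := Prod.swap ⁻¹' symmHull _)
        ((hC _).is_linear_preimage ⟨fun _ _ => rfl, fun _ _ => rfl⟩) (hswap (by simp))
        (hswap (by simp)) (hswap (by simp)) (hswap (by simp)) b2 hxy
  · refine (convexHull_min ?_ convex_balancedSet).trans balancedSet_subset
    have h : ({((0 : ℝ), (0 : ℝ)), ((1 / 2 : ℝ), (1 / 4 : ℝ)), ((3 / 4 : ℝ), (9 / 16 : ℝ)),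
        ((1 : ℝ), (1 : ℝ))} : Set (ℝ × ℝ)) ⊆ balancedSet := by
      rintro p (rfl | rfl | rfl | rfl)
      exacts [zero_zero_mem, half_quarter_mem, three_quarters_mem, one_one_mem]
    refine Set.union_subset h ?_
    rintro _ ⟨p, hp, rfl⟩
    exact swap_mem_balancedSet (h hp)

end TransitProb

theorem mainTheorem2 :
    TransitProb.achievableSet (TransitProb.torus 2) =
      TransitProb.symmHull
        {((0 : ℝ), (0 : ℝ)), ((1 / 2 : ℝ), (1 / 4 : ℝ)), ((3 / 4 : ℝ), (9 / 16 : ℝ)),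
          ((1 : ℝ), (1 : ℝ))} ∧
    ((1 / 4 : ℝ), (1 / 16 : ℝ)) ∈
      TransitProb.regionD 4 \ TransitProb.achievableSet (TransitProb.torus 2) ∧
    ((1 / 16 : ℝ), (1 / 4 : ℝ)) ∈
      TransitProb.regionD 4 \ TransitProb.achievableSet (TransitProb.torus 2) ∧
    ∀ (k : ℕ+) (R : Finset (Fin 2 → ZMod k)), TransitProb.IsBalanced R →
      ∀ ε : ℝ, TransitProb.stayProb (TransitProb.torus 2 k) 2 R = 1 / 4 + ε →
        TransitProb.stayProb (TransitProb.torus 2 k) 2 Rᶜ ≥ 1 / 8 + ε / 2 := by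
  have hD : ((1 / 4 : ℝ), (1 / 16 : ℝ)) ∈
      {p : ℝ × ℝ | ∃ l : ℕ, l ≤ 4 ∧ p = ((l : ℝ) / (4 : ℕ), (l : ℝ) ^ 2 / ((4 : ℕ) : ℝ) ^ 2)} :=
    ⟨1, by norm_num, by norm_num⟩
  refine ⟨TransitProb.achievableSet_torus_two, ⟨subset_convexHull ℝ _ (Or.inl hD), fun h => ?_⟩,
    ⟨subset_convexHull ℝ _ (Or.inr ⟨_, hD, rfl⟩), fun h => ?_⟩, fun k R hR ε hε => ?_⟩
  · have := (TransitProb.belowBounds_of_mem_achievableSet h).1.half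
    norm_num at this
  · have := (TransitProb.belowBounds_of_mem_achievableSet h).2.half
    norm_num at this
  · have := (TransitProb.stayProb_bounds hR).half
    linarith
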